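/- Let $\mathcal A=(\mathcal P,\mathcal L,\mathcal I)$ be a Desargues affine plane: two different points are on exactly one line; through a point off a line $\ell$ there is exactly one line that does not meet $\ell$; there are three non-collinear points; and Desargues' axiom holds for triangles whose joining lines are parallel or concurrent. Two lines are parallel if they are equal or disjoint. Let $O\ne I$ be points and let $\ell^{OI}$ be the line through them. For $A,B\in\ell^{OI}$ choose an auxiliary point $B_1\notin\ell^{OI}$. * The sum $A+B$ is the point in which $\ell^{OI}$ meets the parallel to $BB_1$ through $P_1$, where $P_1$ is the common point of the parallel to $OI$ through $B_1$ and the parallel to $OB_1$ through $A$. * The product $A\cdot B$ is the point in which $\ell^{OI}$ meets the parallel to $BB_1$ through $P_1$, where $P_1$ is the common point of the parallel to $IB_1$ through $A$ and the line $OB_1$. Then both operations are independent of the choice of $B_1$, and $(\ell^{OI},+,\cdot)$ is a skew field with zero $O$ and unit $I$. For $B\in\ell^{OI}$, $B\neq O$, and $X\in\ell^{OI}$ let $r_B(X)=B^{-1}\cdot X$ be the ratio of $X$ and $B$, where $B^{-1}$ is the inverse of $B$ for the multiplication of points. Then, for every point $B\ne O$ of $\ell^{OI}$, the set $$\mathcal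 R_2=\{\,r_B(X) : X\in\ell^{OI}\,\}$$ is closed under the addition and multiplication of points and forms a skew field under them. Its zero is $r_B(O)$, its unit is $r_B(B)$, the opposite of $r_B(X)$ is $r_B(-X)$ for every $X\in\ell^{OI}$, and the multiplicative inverse of $r_B(X)$ is $r_X(B)$ for every $X\in\ell^{OI}$ with $X\neq O$. Moreover, $\mathcal R_2$ is a sub-skew-field of $(\ell^{OI},+,\cdot)$. -/

import Mathlib

/-- Two lines of an incidence structure are parallel: they coincide or have no common point. -/
def Parallel {P L : Type*} [Membership P L] (l m : L) : Prop :=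
  l = m ∨ ∀ p : P, ¬ (p ∈ l ∧ p ∈ m)

/-- An affine plane: an incidence structure of points `P` and lines `L`. -/
class AffinePlane (P L : Type*) [Membership P L] : Prop where
  /-- Two different points are on exactly one line. -/
  exists_unique_line : ∀ p q : P, p ≠ q → ∃! l : L, p ∈ l ∧ q ∈ l
  /-- Playfair's axiom. -/
  exists_unique_parallel : ∀ (p : P) (l : L), p ∉ l →
    ∃! m : L, p ∈ m ∧ ∀ q : P, ¬ (q ∈ l ∧ q ∈ m)
  /-- There are three different points that are not on one line. -/
  exists_noncollinear : ∃ p q r : P, p ≠ q ∧ p ≠ r ∧ q ≠ r ∧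
    ∀ l : L, ¬ (p ∈ l ∧ q ∈ l ∧ r ∈ l)

/-- A Desargues affine plane: an affine plane with Desargues' axiom, for triangles `A B C` and
`A' B' C'` whose joining lines `a = AA'`, `b = BB'`, `c = CC'` are parallel or concurrent.  The
lines `u, v, w` are `AB, BC, AC`, and `u', v', w'` are `A'B', B'C', A'C'`. -/
class DesarguesPlane (P L : Type*) [Membership P L] : Prop extends AffinePlane P L where
  desargues : ∀ (A B C A' B' C' : P) (a b c u v w u' v' w' : L),
    A ∈ a → A' ∈ a → B ∈ b → B' ∈ b → C ∈ c → C' ∈ c →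
    A ∈ u → B ∈ u → A' ∈ u' → B' ∈ u' →
    B ∈ v → C ∈ v → B' ∈ v' → C' ∈ v' →
    A ∈ w → C ∈ w → A' ∈ w' → C' ∈ w' →
    [a, b, c, w, w'].Nodup → A ≠ C → A' ≠ C' → u ≠ u' → v ≠ v' →
    ((Parallel a b ∧ Parallel b c ∧ Parallel a c) ∨ ∃ S : P, S ∈ a ∧ S ∈ b ∧ S ∈ c) →
    Parallel u u' → Parallel v v' → Parallel w w'

namespace AffinePlane

section Basic

variable {P L : Type*} [Membership P L] [AffinePlane P L]

variable (L) in
/-- The line through two different points. -/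
noncomputable def line {p q : P} (h : p ≠ q) : L :=
  (exists_unique_line (L := L) p q h).choose

theorem left_mem_line {p q : P} (h : p ≠ q) : p ∈ line L h :=
  (exists_unique_line (L := L) p q h).choose_spec.1.1

theorem right_mem_line {p q : P} (h : p ≠ q) : q ∈ line L h :=
  (exists_unique_line (L := L) p q h).choose_spec.1.2

theorem line_eq_of_mem {p q : P} (h : p ≠ q) {l : L} (hp : p ∈ l) (hq : q ∈ l) :
    l = line L h :=
  (exists_unique_line (L := L) p q h).unique ⟨hp, hq⟩ ⟨left_mem_line h, right_mem_line h⟩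

theorem eq_of_mem_of_mem {l m : L} {p q : P} (h : p ≠ q)
    (hpl : p ∈ l) (hql : q ∈ l) (hpm : p ∈ m) (hqm : q ∈ m) : l = m :=
  (line_eq_of_mem h hpl hql).trans (line_eq_of_mem h hpm hqm).symm

theorem eq_of_parallel_of_mem {l m : L} (h : Parallel l m) {p : P} (hl : p ∈ l) (hm : p ∈ m) :
    l = m :=
  h.resolve_right fun h' => h' p ⟨hl, hm⟩

theorem exists_unique_parallel_through (p : P) (l : L) : ∃! m : L, p ∈ m ∧ Parallel l m := by
  by_cases hp : p ∈ l
  · exact ⟨l, ⟨hp, Or.inl rfl⟩, fun m hm => (eq_of_parallel_of_mem hm.2 hp hm.1).symm⟩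
  · obtain ⟨m, hm, hu⟩ := exists_unique_parallel p l hp
    refine ⟨m, ⟨hm.1, Or.inr hm.2⟩, ?_⟩
    rintro k ⟨hpk, rfl | hk⟩
    · exact absurd hpk hp
    · exact hu k ⟨hpk, hk⟩

/-- The line through `p` that is parallel (possibly equal) to `l`. -/
noncomputable def parallelThrough (p : P) (l : L) : L :=
  (exists_unique_parallel_through p l).choose

theorem mem_parallelThrough (p : P) (l : L) : p ∈ parallelThrough p l :=
  (exists_unique_parallel_through p l).choose_spec.1.1

theorem parallel_parallelThrough (p : P) (l : L) : Parallel l (parallelThrough p l) :=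
  (exists_unique_parallel_through p l).choose_spec.1.2

theorem eq_parallelThrough {p : P} {l m : L} (hp : p ∈ m) (h : Parallel l m) :
    m = parallelThrough p l :=
  (exists_unique_parallel_through p l).unique ⟨hp, h⟩
    ⟨mem_parallelThrough p l, parallel_parallelThrough p l⟩

theorem parallel_refl (l : L) : Parallel l l := Or.inl rfl

theorem parallel_symm {l m : L} (h : Parallel l m) : Parallel m l := by
  rcases h with rfl | h
  · exact Or.inl rfl
  · exact Or.inr fun p hp => h p ⟨hp.2, hp.1⟩

theorem parallel_trans {l m k : L} (h : Parallel l m) (h' : Parallel m k) : Parallel l k := by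
  by_cases hlk : ∃ p : P, p ∈ l ∧ p ∈ k
  · obtain ⟨p, hl, hk⟩ := hlk
    exact Or.inl ((eq_parallelThrough hl (parallel_symm h)).trans (eq_parallelThrough hk h').symm)
  · exact Or.inr fun p hp => hlk ⟨p, hp⟩

theorem exists_unique_meet {l m : L} (h : ¬ Parallel l m) : ∃! p : P, p ∈ l ∧ p ∈ m := by
  obtain ⟨p, hp⟩ : ∃ p : P, p ∈ l ∧ p ∈ m := by
    by_contra hn
    exact h (Or.inr fun p hp => hn ⟨p, hp⟩)
  refine ⟨p, hp, fun q hq => ?_⟩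
  by_contra hne
  exact h (Or.inl (eq_of_mem_of_mem hne hq.1 hp.1 hq.2 hp.2))

/-- The common point of two lines that are not parallel. -/
noncomputable def meet {l m : L} (h : ¬ Parallel l m) : P := (exists_unique_meet h).choose

theorem meet_mem_left {l m : L} (h : ¬ Parallel l m) : meet h ∈ l :=
  (exists_unique_meet h).choose_spec.1.1

theorem meet_mem_right {l m : L} (h : ¬ Parallel l m) : meet h ∈ m :=
  (exists_unique_meet h).choose_spec.1.2

theorem eq_meet {l m : L} (h : ¬ Parallel l m) {p : P} (hl : p ∈ l) (hm : p ∈ m) : p = meet h :=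
  (exists_unique_meet h).unique ⟨hl, hm⟩ ⟨meet_mem_left h, meet_mem_right h⟩

theorem ne_of_mem_of_notMem {l : L} {p q : P} (hp : p ∈ l) (hq : q ∉ l) : p ≠ q :=
  fun h => hq (h ▸ hp)

/-- Lines with a common point, one of which has a point off the other, are not parallel. -/
theorem not_parallel_of_mem {l m : L} {p q : P} (hpl : p ∈ l) (hpm : p ∈ m) (hql : q ∉ l)
    (hqm : q ∈ m) : ¬ Parallel l m :=
  fun h => hql (eq_of_parallel_of_mem h hpl hpm ▸ hqm)

/-- Every line misses some point. -/
theorem exists_notMem (l : L) : ∃ p : P, p ∉ l := by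
  obtain ⟨p, q, r, -, -, -, h⟩ := exists_noncollinear (P := P) (L := L)
  by_contra hn
  push Not at hn
  exact h l ⟨hn p, hn q, hn r⟩

end Basic

end AffinePlane

open AffinePlane in
/-- The points of the line `OI`, for different points `O` and `I`. -/
def PointsOn {P : Type*} (L : Type*) [Membership P L] [AffinePlane P L] {O I : P}
    (hOI : O ≠ I) : Type _ :=
  {X : P // X ∈ line L hOI}

namespace PointsOn

open AffinePlane

variable {P L : Type*} [Membership P L] [AffinePlane P L] {O I : P} {hOI : O ≠ I}

/-- The point `O` of the line `OI`. -/
def ptO : PointsOn L hOI := ⟨O, left_mem_line hOI⟩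

/-- The point `I` of the line `OI`. -/
def ptI : PointsOn L hOI := ⟨I, right_mem_line hOI⟩

section Construction

variable {B₁ : P}

theorem ne_aux (h : B₁ ∉ line L hOI) (X : PointsOn L hOI) : X.1 ≠ B₁ :=
  ne_of_mem_of_notMem X.2 h

theorem not_parallel_join (h : B₁ ∉ line L hOI) (X : PointsOn L hOI) :
    ¬ Parallel (line L hOI) (line L (ne_aux h X)) :=
  not_parallel_of_mem X.2 (left_mem_line _) h (right_mem_line _)

theorem add_not_parallel (h : B₁ ∉ line L hOI) (A : PointsOn L hOI) :
    ¬ Parallel (parallelThrough B₁ (line L hOI))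
      (parallelThrough A.1 (line L (ne_aux h (ptO : PointsOn L hOI)))) := fun hp =>
  not_parallel_join h ptO <| parallel_trans (parallel_parallelThrough _ _) <|
    parallel_trans hp (parallel_symm (parallel_parallelThrough _ _))

theorem last_not_parallel (h : B₁ ∉ line L hOI) (B : PointsOn L hOI) (P₁ : P) :
    ¬ Parallel (parallelThrough P₁ (line L (ne_aux h B))) (line L hOI) := fun hp =>
  not_parallel_join h B <|
    parallel_symm (parallel_trans (parallel_parallelThrough _ _) hp)

theorem mul_not_parallel (h : B₁ ∉ line L hOI) (A : PointsOn L hOI) :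
    ¬ Parallel (parallelThrough A.1 (line L (ne_aux h (ptI : PointsOn L hOI))))
      (line L (ne_aux h (ptO : PointsOn L hOI))) := fun hp => by
  have h1 : Parallel (line L (ne_aux h (ptI : PointsOn L hOI)))
      (line L (ne_aux h (ptO : PointsOn L hOI))) :=
    parallel_trans (parallel_parallelThrough _ _) hp
  have h2 := eq_of_parallel_of_mem h1 (right_mem_line _) (right_mem_line _)
  have hI : I ∈ line L (ne_aux h (ptO : PointsOn L hOI)) :=
    h2 ▸ left_mem_line (ne_aux h (ptI : PointsOn L hOI))
  have hO : O ∈ line L (ne_aux h (ptO : PointsOn L hOI)) := left_mem_line (ne_aux h ptO)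
  exact not_parallel_join h ptO (Or.inl (line_eq_of_mem hOI hO hI).symm)

/-- The sum of `A` and `B` constructed with the auxiliary point `B₁` off the line `OI`: the
parallel to `OI` through `B₁` and the parallel to `OB₁` through `A` meet in a point `P₁`, and the
parallel to `BB₁` through `P₁` meets `OI` in the sum. -/
noncomputable def addVia (h : B₁ ∉ line L hOI) (A B : PointsOn L hOI) : PointsOn L hOI :=
  let P₁ : P := meet (add_not_parallel h A)
  ⟨meet (last_not_parallel h B P₁), meet_mem_right _⟩

/-- The product of `A` and `B` constructed with the auxiliary point `B₁` off the line `OI`: the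
parallel to `IB₁` through `A` meets `OB₁` in a point `P₁`, and the parallel to `BB₁` through `P₁`
meets `OI` in the product. -/
noncomputable def mulVia (h : B₁ ∉ line L hOI) (A B : PointsOn L hOI) : PointsOn L hOI :=
  let P₁ : P := meet (mul_not_parallel h A)
  ⟨meet (last_not_parallel h B P₁), meet_mem_right _⟩

end Construction

/-- Addition of points of the line `OI`, for some choice of the auxiliary point. -/
noncomputable def add (A B : PointsOn L hOI) : PointsOn L hOI :=
  addVia (exists_notMem (line L hOI)).choose_spec A B

/-- Multiplication of points of the line `OI`, for some choice of the auxiliary point. -/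
noncomputable def mul (A B : PointsOn L hOI) : PointsOn L hOI :=
  mulVia (exists_notMem (line L hOI)).choose_spec A B

open Classical in
/-- The inverse point of `A` for multiplication of points (`O` where there is none). -/
noncomputable def inv (A : PointsOn L hOI) : PointsOn L hOI :=
  if h : ∃ C : PointsOn L hOI, mul A C = ptI ∧ mul C A = ptI then h.choose else ptO

/-- The ratio of two points, `r_B(X) = r(X : B) = B⁻¹X`. -/
noncomputable def ratio (B X : PointsOn L hOI) : PointsOn L hOI := mul (inv B) X

/-- The ratio-maps-set: the set of all `r_B(X)`, for `X` on the line `OI`. -/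
def ratioSet (B : PointsOn L hOI) : Set (PointsOn L hOI) :=
  {R | ∃ X : PointsOn L hOI, R = ratio B X}

theorem ratio_mem (B X : PointsOn L hOI) : ratio B X ∈ ratioSet B := ⟨X, rfl⟩

end PointsOn

/-! Both constructions trace a dilatation, that is, a map of the plane sending each segment to a
parallel one. Let τ_A be the translation with O ↦ A (`translation A`) and σ_A the homothety with O ↦
O, I ↦ A (`scaling A`). The point P₁ is τ_A(B₁) for the sum and σ_A(B₁) for the product, so the
results are τ_A(B) and σ_A(B), whatever B₁ is (`addVia_eq`, `mulVia_eq`).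

Since a dilatation is determined by two values and a translation by one, the axioms become
identities between maps: τ_{A+B} = τ_A τ_B and σ_{AB} = σ_A σ_B give associativity, and σ_A τ_B =
τ_{AB} σ_A gives left distributivity. Right distributivity holds because a pointwise sum of
dilatations is a dilatation (`isDilatation_sum`), which rests on the commutativity of translations.
Constant maps count as dilatations, so σ_O is no exception.

Desargues' axiom is what makes these maps exist: `IsPencil.exists_map` builds them on a pencil of
parallel lines (translations) or of lines through O (homotheties).

Finally R = B⁻¹(BR), so every point is a ratio: the ratio set is the whole line, and its formulas
are identities of the skew field. -/

namespace AffinePlane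

/-! ### Directions and parallel segments, degenerate ones included -/

section Along

variable {P L : Type*} [Membership P L] [AffinePlane P L]

/-- The points `X` and `Y` lie on a common parallel to `l`. -/
def Along (l : L) (X Y : P) : Prop := Y ∈ parallelThrough X l

theorem along_of_mem {l m : L} (h : Parallel l m) {X Y : P} (hX : X ∈ m) (hY : Y ∈ m) :
    Along l X Y := by
  rw [Along, ← eq_parallelThrough hX h]
  exact hY

theorem Along.mem {l m : L} {X Y : P} (h : Along l X Y) (hm : Parallel l m) (hX : X ∈ m) :
    Y ∈ m :=
  (eq_parallelThrough hX hm).symm ▸ h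

@[refl] theorem Along.refl (l : L) (X : P) : Along l X X := mem_parallelThrough X l

@[symm] theorem Along.symm {l : L} {X Y : P} (h : Along l X Y) : Along l Y X :=
  along_of_mem (parallel_parallelThrough X l) h (mem_parallelThrough X l)

theorem Along.trans {l : L} {X Y Z : P} (h : Along l X Y) (h' : Along l Y Z) : Along l X Z :=
  along_of_mem (parallel_parallelThrough Y l) h.symm h'

theorem Along.congr {l m : L} {X Y : P} (h : Along l X Y) (hlm : Parallel l m) : Along m X Y :=
  along_of_mem (parallel_trans (parallel_symm hlm) (parallel_parallelThrough X l))
    (mem_parallelThrough X l) h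

theorem Along.parallel {l m : L} {X Y : P} (h : Along l X Y) (hXY : X ≠ Y) (hX : X ∈ m)
    (hY : Y ∈ m) : Parallel l m := by
  rw [eq_of_mem_of_mem hXY hX hY (mem_parallelThrough X l) h]
  exact parallel_parallelThrough X l

/-- The standard way below to identify two points: they are joined in two different directions. -/
theorem Along.eq {l m : L} {X Y : P} (h : Along l X Y) (h' : Along m X Y)
    (hlm : ¬ Parallel l m) : X = Y := by
  by_contra hXY
  exact hlm (parallel_trans (h.parallel hXY (mem_parallelThrough X m) h')
    (parallel_symm (parallel_parallelThrough X m)))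

theorem exists_line_through (X Y : P) : ∃ l : L, X ∈ l ∧ Y ∈ l := by
  by_cases h : X = Y
  · obtain ⟨p, q, r, hpq, -⟩ := exists_noncollinear (P := P) (L := L)
    exact ⟨parallelThrough X (line L hpq), mem_parallelThrough _ _, h ▸ mem_parallelThrough _ _⟩
  · exact ⟨line L h, left_mem_line h, right_mem_line h⟩

variable (L) in
/-- Every direction of the segment `XY` is a direction of the segment `X'Y'`. -/
def ParallelSegments (X Y X' Y' : P) : Prop := ∀ l : L, Along l X Y → Along l X' Y'

namespace ParallelSegments

variable {X Y Z X' Y' Z' : P}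

theorem swap (h : ParallelSegments L X Y X' Y') : ParallelSegments L Y X Y' X' :=
  fun l hl => (h l hl.symm).symm

theorem of_along {l : L} (hXY : X ≠ Y) (h : Along l X Y) (h' : Along l X' Y') :
    ParallelSegments L X Y X' Y' := fun _ hm =>
  h'.congr <| parallel_trans (h.parallel hXY (mem_parallelThrough _ _) hm)
    (parallel_symm (parallel_parallelThrough _ _))

theorem of_eq (h : X' = Y') : ParallelSegments L X Y X' Y' := fun l _ => h ▸ Along.refl l X'

theorem inverse (h : ParallelSegments L X Y X' Y') (hne : X' ≠ Y') :
    ParallelSegments L X' Y' X Y := by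
  obtain ⟨l, hX, hY⟩ := exists_line_through (L := L) X Y
  have h1 := along_of_mem (parallel_refl l) hX hY
  exact of_along hne (h l h1) h1

end ParallelSegments

end Along

/-! ### Pencils of lines and the use of Desargues' axiom -/

section Pencil

variable {P L : Type*} [Membership P L]

/-- The lines `c X`, for `X` in `D`, are the lines of a pencil of parallel or of concurrent lines,
and `D` consists of the points that are on just one line of the pencil. -/
structure IsPencil [AffinePlane P L] (D : Set P) (c : P → L) : Prop where
  mem : ∀ X ∈ D, X ∈ c X
  eq_of_mem : ∀ X ∈ D, ∀ Y ∈ D, Y ∈ c X → c Y = c X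
  parallel_or_concurrent : (∀ X ∈ D, ∀ Y ∈ D, Parallel (c X) (c Y)) ∨ ∃ S, ∀ X ∈ D, S ∈ c X
  mem_of_along : ∀ X ∈ D, ∀ X' ∈ D, ∀ Y ∈ D, ∀ (Y' : P) (l : L), c X' = c X → c X ≠ c Y →
    X ∈ l → Y ∈ l → Along l X' Y' → Y' ∈ c Y → Y' ∈ D

namespace IsPencil

variable {D : Set P} {c : P → L}

section Affine

variable [AffinePlane P L]

theorem line_ne (hP : IsPencil D c) {X Y Z : P} (hX : X ∈ D) (hY : Y ∈ D) (hZ : Z ∈ D)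
    (hXY : c X ≠ c Y) {l : L} (hXl : X ∈ l) (hYl : Y ∈ l) : l ≠ c Z := by
  rintro rfl
  exact hXY ((hP.eq_of_mem Z hZ X hX hXl).trans (hP.eq_of_mem Z hZ Y hY hYl).symm)

theorem not_parallel (hP : IsPencil D c) {X Y : P} (hX : X ∈ D) (hY : Y ∈ D)
    (hXY : c X ≠ c Y) {l : L} (hXl : X ∈ l) (hYl : Y ∈ l) : ¬ Parallel l (c Y) := fun h =>
  hP.line_ne hX hY hY hXY hXl hYl (eq_of_parallel_of_mem h hYl (hP.mem Y hY))

/-- `Y'` is where the parallel to `XY` through `X'` meets the pencil line of `Y`. -/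
theorem exists_image (hP : IsPencil D c) {X X' Y : P} (hX : X ∈ D) (hX' : X' ∈ D) (hY : Y ∈ D)
    (hXX : c X' = c X) (hXY : c X ≠ c Y) :
    ∃ Y' ∈ D, c Y' = c Y ∧ ParallelSegments L X Y X' Y' := by
  have hne := ne_of_apply_ne c hXY
  have hp : ¬ Parallel (parallelThrough X' (line L hne)) (c Y) := fun h =>
    hP.not_parallel hX hY hXY (left_mem_line hne) (right_mem_line hne)
      (parallel_trans (parallel_parallelThrough _ _) h)
  have hal : Along (line L hne) X' (meet hp) := meet_mem_left hp
  have hD := hP.mem_of_along X hX X' hX' Y hY _ _ hXX hXY (left_mem_line hne)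
    (right_mem_line hne) hal (meet_mem_right hp)
  exact ⟨meet hp, hD, hP.eq_of_mem Y hY _ hD (meet_mem_right hp),
    .of_along hne (along_of_mem (parallel_refl _) (left_mem_line hne) (right_mem_line hne)) hal⟩

theorem image_unique (hP : IsPencil D c) {X X' Y Y' Y'' : P} (hX : X ∈ D) (hY : Y ∈ D)
    (hXY : c X ≠ c Y) (hY' : Y' ∈ c Y) (hY'' : Y'' ∈ c Y) (h' : ParallelSegments L X Y X' Y')
    (h'' : ParallelSegments L X Y X' Y'') : Y' = Y'' := by
  obtain ⟨l, hXl, hYl⟩ := exists_line_through (L := L) X Y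
  have h1 := along_of_mem (parallel_refl l) hXl hYl
  exact Along.eq ((h' l h1).symm.trans (h'' l h1)) (along_of_mem (parallel_refl (c Y)) hY' hY'')
    (hP.not_parallel hX hY hXY hXl hYl)

theorem image_eq_of_fixed (hP : IsPencil D c) {X X' Y Y' : P} (hX : X ∈ D) (hY : Y ∈ D)
    (hXY : c X ≠ c Y) (hY' : Y' ∈ c Y) (h : ParallelSegments L X Y X' Y') (hXX : X' = X) :
    Y' = Y := by
  subst hXX
  exact hP.image_unique hX hY hXY hY' (hP.mem Y hY) h fun _ h => h

theorem parallelSegments_of_eq (hP : IsPencil D c) {X X' Y Y' : P} (hX : X ∈ D) (hX' : X' ∈ D)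
    (hY : Y ∈ D) (hY' : Y' ∈ D) (hXX : c X' = c X) (hYY : c Y' = c Y) (hXY : c X = c Y)
    (h : X = Y → X' = Y') : ParallelSegments L X Y X' Y' := by
  by_cases hne : X = Y
  · exact .of_eq (h hne)
  · exact .of_along (l := c X) hne
      (along_of_mem (parallel_refl _) (hP.mem X hX) (hXY ▸ hP.mem Y hY))
      (along_of_mem (parallel_refl _) (hXX ▸ hP.mem X' hX') (hXY ▸ hYY ▸ hP.mem Y' hY'))

end Affine

variable [DesarguesPlane P L]

/-- Desargues' axiom freed of its nondegeneracy conditions. If one vertex is fixed, all are;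
otherwise a coincidence of corresponding sides on `XY` or `YZ` would make that side a line of the
pencil. -/
theorem parallelSegments_trans (hP : IsPencil D c) {X Y Z X' Y' Z' : P}
    (hX : X ∈ D) (hY : Y ∈ D) (hZ : Z ∈ D) (hX' : X' ∈ D) (hY' : Y' ∈ D) (hZ' : Z' ∈ D)
    (hXX : c X' = c X) (hYY : c Y' = c Y) (hZZ : c Z' = c Z)
    (hXY : c X ≠ c Y) (hYZ : c Y ≠ c Z) (hXZ : c X ≠ c Z)
    (h₁ : ParallelSegments L X Y X' Y') (h₂ : ParallelSegments L Y Z Y' Z') :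
    ParallelSegments L X Z X' Z' := by
  by_cases hfix : X' = X
  · have hY1 := hP.image_eq_of_fixed hX hY hXY (hYY ▸ hP.mem Y' hY') h₁ hfix
    have hZ1 := hP.image_eq_of_fixed hY hZ hYZ (hZZ ▸ hP.mem Z' hZ') h₂ hY1
    subst hfix hZ1
    exact fun _ h => h
  have hfixY : Y' ≠ Y := fun h =>
    hfix (hP.image_eq_of_fixed hY hX hXY.symm (hXX ▸ hP.mem X' hX') h₁.swap h)
  obtain ⟨u, hXu, hYu⟩ := exists_line_through (L := L) X Y
  obtain ⟨v, hYv, hZv⟩ := exists_line_through (L := L) Y Z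
  obtain ⟨w, hXw, hZw⟩ := exists_line_through (L := L) X Z
  obtain ⟨u', hXu', hYu'⟩ := exists_line_through (L := L) X' Y'
  obtain ⟨v', hYv', hZv'⟩ := exists_line_through (L := L) Y' Z'
  obtain ⟨w', hXw', hZw'⟩ := exists_line_through (L := L) X' Z'
  have hXY' : c X' ≠ c Y' := by rwa [hXX, hYY]
  have hYZ' : c Y' ≠ c Z' := by rwa [hZZ, hYY]
  have hXZ' : c X' ≠ c Z' := by rwa [hXX, hZZ]
  have hu : Parallel u u' :=
    (h₁ u (along_of_mem (parallel_refl u) hXu hYu)).parallel (ne_of_apply_ne c hXY') hXu' hYu'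
  have hv : Parallel v v' :=
    (h₂ v (along_of_mem (parallel_refl v) hYv hZv)).parallel (ne_of_apply_ne c hYZ') hYv' hZv'
  have huu : u ≠ u' := by
    rintro rfl
    exact hP.line_ne hX hY hX hXY hXu hYu
      (eq_of_mem_of_mem hfix hXu' hXu (hXX ▸ hP.mem X' hX') (hP.mem X hX))
  have hvv : v ≠ v' := by
    rintro rfl
    exact hP.line_ne hY hZ hY hYZ hYv hZv
      (eq_of_mem_of_mem hfixY hYv' hYv (hYY ▸ hP.mem Y' hY') (hP.mem Y hY))
  have hw : Parallel w w' := by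
    by_cases hww : w = w'
    · exact Or.inl hww
    refine DesarguesPlane.desargues X Y Z X' Y' Z' (c X) (c Y) (c Z) u v w u' v' w'
      (hP.mem X hX) (hXX ▸ hP.mem X' hX') (hP.mem Y hY) (hYY ▸ hP.mem Y' hY')
      (hP.mem Z hZ) (hZZ ▸ hP.mem Z' hZ') hXu hYu hXu' hYu' hYv hZv hYv' hZv' hXw hZw hXw' hZw'
      ?_ (ne_of_apply_ne c hXZ) (ne_of_apply_ne c hXZ') huu hvv ?_ hu hv
    · have hw1 : ∀ T ∈ D, c T ≠ w := fun T hT => (hP.line_ne hX hZ hT hXZ hXw hZw).symm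
      have hw2 : ∀ T ∈ D, c T ≠ w' := fun T hT => (hP.line_ne hX' hZ' hT hXZ' hXw' hZw').symm
      simp [hXY, hYZ, hXZ, hww, hw1 X hX, hw1 Y hY, hw1 Z hZ, hw2 X hX, hw2 Y hY, hw2 Z hZ]
    · rcases hP.parallel_or_concurrent with h | ⟨S, h⟩
      · exact Or.inl ⟨h X hX Y hY, h Y hY Z hZ, h X hX Z hZ⟩
      · exact Or.inr ⟨S, h X hX, h Y hY, h Z hZ⟩
  exact .of_along (ne_of_apply_ne c hXZ) (along_of_mem (parallel_refl w) hXw hZw) (along_of_mem hw hXw' hZw')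

/-- A perspectivity of a pencil with a given value at a point. The hypothesis `h₃` says
that two lines of the pencil are never all of it, or that what a third line is needed for holds. -/
theorem exists_map (hP : IsPencil D c) {I A B : P} (hI : I ∈ D) (hA : A ∈ D) (hB : B ∈ D)
    (hIA : c A = c I) (hIB : c I ≠ c B)
    (h₃ : (∃ Z ∈ D, c I ≠ c Z ∧ c B ≠ c Z) ∨
      ∀ B' ∈ D, ∀ X ∈ D, ∀ X' ∈ D, ∀ Y ∈ D, ∀ Y' ∈ D, c B' = c B → c X = c I → c X' = c I →
        c Y = c B → c Y' = c B → ParallelSegments L I B A B' → ParallelSegments L B X B' X' →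
        ParallelSegments L I Y A Y' → ParallelSegments L X Y X' Y') :
    ∃ f : P → P, f I = A ∧ (∀ X ∈ D, f X ∈ D ∧ c (f X) = c X) ∧
      ∀ X ∈ D, ∀ Y ∈ D, ParallelSegments L X Y (f X) (f Y) := by
  -- Images are constructed from `I ↦ A` off the line of `I`, and from `B ↦ B'` off the line of `B`.
  -- Where both constructions apply, Desargues makes them agree.
  obtain ⟨B', hB', hBB, hB1⟩ := hP.exists_image hI hA hB hIA hIB
  have key : ∀ X, ∃ X', X ∈ D → (X' ∈ D ∧ c X' = c X) ∧
      (c I ≠ c X → ParallelSegments L I X A X') ∧ (c B ≠ c X → ParallelSegments L B X B' X') := by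
    intro X
    by_cases hX : X ∈ D
    swap
    · exact ⟨X, fun h => absurd h hX⟩
    by_cases hIX : c I = c X
    · have hBX : c B ≠ c X := fun h => hIB (hIX.trans h.symm)
      obtain ⟨X', h1, h2, h3⟩ := hP.exists_image hB hB' hX hBB hBX
      exact ⟨X', fun _ => ⟨⟨h1, h2⟩, fun h => absurd hIX h, fun _ => h3⟩⟩
    · obtain ⟨X', h1, h2, h3⟩ := hP.exists_image hI hA hX hIA hIX
      exact ⟨X', fun _ => ⟨⟨h1, h2⟩, fun _ => h3, fun h =>
        hP.parallelSegments_trans hB hI hX hB' hA h1 hBB hIA h2 hIB.symm hIX h hB1.swap h3⟩⟩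
  choose f hf using key
  have hfI : f I = A := by
    obtain ⟨⟨h1, h2⟩, -, h3⟩ := hf I hI
    exact hP.image_unique hB hI hIB.symm (h2 ▸ hP.mem _ h1) (hIA ▸ hP.mem _ hA) (h3 hIB.symm)
      hB1.swap
  -- The hard pair: neither `I` nor `B` is off both lines, so a third line of the pencil has to
  -- mediate.
  have hmain : ∀ X ∈ D, ∀ Y ∈ D, c X = c I → c Y = c B → ParallelSegments L X Y (f X) (f Y) := by
    intro X hX Y hY hXI hYB
    obtain ⟨⟨hX1, hX2⟩, -, hX3⟩ := hf X hX
    obtain ⟨⟨hY1, hY2⟩, hY3, -⟩ := hf Y hY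
    have hBX : c B ≠ c X := hXI ▸ hIB.symm
    have hIY : c I ≠ c Y := hYB ▸ hIB
    rcases h₃ with ⟨Z, hZ, hIZ, hBZ⟩ | h₃
    · obtain ⟨⟨hZ1, hZ2⟩, hZ3, hZ4⟩ := hf Z hZ
      have hXZ : c X ≠ c Z := hXI ▸ hIZ
      have hYZ : c Y ≠ c Z := hYB ▸ hBZ
      have h1 : ParallelSegments L X Z (f X) (f Z) :=
        hP.parallelSegments_trans hX hB hZ hX1 hB' hZ1 hX2 hBB hZ2 hBX.symm hBZ hXZ
          (hX3 hBX).swap (hZ4 hBZ)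
      have h2 : ParallelSegments L Z Y (f Z) (f Y) :=
        hP.parallelSegments_trans hZ hI hY hZ1 hA hY1 hZ2 hIA hY2 hIZ.symm hIY hYZ.symm
          (hZ3 hIZ).swap (hY3 hIY)
      exact hP.parallelSegments_trans hX hZ hY hX1 hZ1 hY1 hX2 hZ2 hY2 hXZ hYZ.symm
        (hXI ▸ hIY) h1 h2
    · exact h₃ B' hB' X hX _ hX1 Y hY _ hY1 hBB hXI (hX2.trans hXI) hYB (hY2.trans hYB) hB1
        (hX3 hBX) (hY3 hIY)
  refine ⟨f, hfI, fun X hX => (hf X hX).1, fun X hX Y hY => ?_⟩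
  obtain ⟨⟨hX1, hX2⟩, hX3, hX4⟩ := hf X hX
  obtain ⟨⟨hY1, hY2⟩, hY3, hY4⟩ := hf Y hY
  by_cases hXY : c X = c Y
  · exact hP.parallelSegments_of_eq hX hX1 hY hY1 hX2 hY2 hXY fun h => h ▸ rfl
  by_cases hXI : c X = c I
  · by_cases hYB : c Y = c B
    · exact hmain X hX Y hY hXI hYB
    · have hBX : c B ≠ c X := hXI ▸ hIB.symm
      exact hP.parallelSegments_trans hX hB hY hX1 hB' hY1 hX2 hBB hY2 hBX.symm (Ne.symm hYB) hXY
        (hX4 hBX).swap (hY4 (Ne.symm hYB))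
  by_cases hYI : c Y = c I
  · by_cases hXB : c X = c B
    · exact (hmain Y hY X hX hYI hXB).swap
    · have hBY : c B ≠ c Y := hYI ▸ hIB.symm
      exact hP.parallelSegments_trans hX hB hY hX1 hB' hY1 hX2 hBB hY2 hXB hBY hXY
        (hX4 (Ne.symm hXB)).swap (hY4 hBY)
  · exact hP.parallelSegments_trans hX hI hY hX1 hA hY1 hX2 hIA hY2 hXI (Ne.symm hYI) hXY
      (hX3 (Ne.symm hXI)).swap (hY3 (Ne.symm hYI))

end IsPencil

end Pencil


/-! ### Dilatations and translations: rigidity and composition -/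

section Dilatation

variable {P L : Type*} [Membership P L]

section Affine

variable [AffinePlane P L]

variable (L) in
/-- A dilatation maps segments to parallel segments. Constant maps are allowed. -/
def IsDilatation (f : P → P) : Prop := ∀ X Y : P, ParallelSegments L X Y (f X) (f Y)

namespace IsDilatation

variable {f g : P → P}

theorem id : IsDilatation L (id : P → P) := fun _ _ _ h => h

theorem const (X : P) : IsDilatation L (Function.const P X) := fun _ _ _ _ => Along.refl _ _

theorem comp (hf : IsDilatation L f) (hg : IsDilatation L g) : IsDilatation L (f ∘ g) :=
  fun X Y l h => hf _ _ l (hg X Y l h)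

theorem mem_of_fixed (hf : IsDilatation L f) {O X : P} (hO : f O = O) {l : L} (hOl : O ∈ l)
    (hX : X ∈ l) : f X ∈ l := by
  have h := hf O X l (along_of_mem (parallel_refl l) hOl hX)
  rw [hO] at h
  exact h.mem (parallel_refl l) hOl

theorem eq_of_notMem (hf : IsDilatation L f) (hg : IsDilatation L g) {X Y Z : P} {l : L}
    (hX : X ∈ l) (hY : Y ∈ l) (hZ : Z ∉ l) (hXY : X ≠ Y) (hfX : f X = g X) (hfY : f Y = g Y) :
    f Z = g Z := by
  obtain ⟨m, hXm, hZm⟩ := exists_line_through (L := L) X Z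
  obtain ⟨k, hYk, hZk⟩ := exists_line_through (L := L) Y Z
  have hmk : ¬ Parallel m k := fun h => by
    obtain rfl := eq_of_parallel_of_mem h hZm hZk
    exact hZ (eq_of_mem_of_mem hXY hX hY hXm hYk ▸ hZm)
  have h1 := along_of_mem (parallel_refl m) hXm hZm
  have h2 := along_of_mem (parallel_refl k) hYk hZk
  exact Along.eq ((hf _ _ m h1).symm.trans (hfX ▸ hg _ _ m h1))
    ((hf _ _ k h2).symm.trans (hfY ▸ hg _ _ k h2)) hmk

/-- A dilatation is determined by its values at two different points. -/
theorem ext (hf : IsDilatation L f) (hg : IsDilatation L g) {X Y : P} (hXY : X ≠ Y)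
    (hfX : f X = g X) (hfY : f Y = g Y) : f = g := by
  funext Z
  obtain ⟨l, hX, hY⟩ := exists_line_through (L := L) X Y
  by_cases hZ : Z ∈ l
  · obtain ⟨W, hW⟩ := exists_notMem l
    have hfW := hf.eq_of_notMem hg hX hY hW hXY hfX hfY
    have hXW := ne_of_mem_of_notMem hX hW
    by_cases hXZ : Z = X
    · exact hXZ ▸ hfX
    · refine hf.eq_of_notMem hg (left_mem_line (L := L) hXW) (right_mem_line _) (fun h => hW ?_)
        hXW hfX hfW
      rw [eq_of_mem_of_mem hXZ hZ hX h (left_mem_line (L := L) hXW)]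
      exact right_mem_line hXW
  · exact hf.eq_of_notMem hg hX hY hZ hXY hfX hfY

end IsDilatation

/-- A translation in the direction of the line `l`. -/
def IsTranslationAlong (l : L) (f : P → P) : Prop :=
  IsDilatation L f ∧ ∀ X : P, Along l X (f X)

namespace IsTranslationAlong

variable {l m : L} {f g : P → P}

theorem id (l : L) : IsTranslationAlong l (id : P → P) := ⟨.id, fun X => Along.refl l X⟩

theorem comp (hf : IsTranslationAlong l f) (hg : IsTranslationAlong l g) :
    IsTranslationAlong l (f ∘ g) :=
  ⟨hf.1.comp hg.1, fun X => (hg.2 X).trans (hf.2 (g X))⟩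

theorem congr (hf : IsTranslationAlong l f) (h : Parallel l m) : IsTranslationAlong m f :=
  ⟨hf.1, fun X => (hf.2 X).congr h⟩

theorem ext (hf : IsTranslationAlong l f) (hg : IsTranslationAlong l g) {X : P}
    (h : f X = g X) : f = g := by
  obtain ⟨Y, hY⟩ := exists_notMem (parallelThrough X l)
  obtain ⟨m, hXm, hYm⟩ := exists_line_through (L := L) X Y
  have hXY := ne_of_mem_of_notMem (mem_parallelThrough X l) hY
  have h1 := along_of_mem (parallel_refl m) hXm hYm
  have hml : ¬ Parallel l m := fun h => hY (along_of_mem h hXm hYm)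
  exact hf.1.ext hg.1 hXY h <| Along.eq ((hf.2 Y).symm.trans (hg.2 Y))
    ((hf.1 _ _ m h1).symm.trans (h ▸ hg.1 _ _ m h1)) hml

theorem eq_id (hf : IsTranslationAlong l f) {X : P} (h : f X = X) : f = _root_.id :=
  hf.ext (.id l) h

end IsTranslationAlong

/-- A dilatation without fixed points is a translation. -/
theorem IsDilatation.isTranslationAlong {f : P → P} (hf : IsDilatation L f)
    (hfix : ∀ X, f X ≠ X) {X : P} {l : L} (hX : X ∈ l) (hfX : f X ∈ l) :
    IsTranslationAlong l f := by
  -- A line joining a point to its image is mapped into itself, so two such lines that are not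
  -- parallel would meet in a fixed point.
  have hinv : ∀ {m : L} {Y Z : P}, Y ∈ m → f Y ∈ m → Z ∈ m → f Z ∈ m := fun {m Y Z} hY hfY hZ =>
    (hf Y Z m (along_of_mem (parallel_refl m) hY hZ)).mem (parallel_refl m) hfY
  refine ⟨hf, fun Y => ?_⟩
  obtain ⟨m, hY, hfY⟩ := exists_line_through (L := L) Y (f Y)
  by_cases h : Parallel l m
  · exact along_of_mem h hY hfY
  · exact absurd ((eq_meet h (hinv hX hfX (meet_mem_left h)) (hinv hY hfY (meet_mem_right h))))
      (hfix _)

variable (L) in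
/-- A translation is a translation in the direction of some line. -/
def IsTranslation (f : P → P) : Prop := ∃ l : L, IsTranslationAlong l f

namespace IsTranslation

variable {f g : P → P}

theorem isDilatation (hf : IsTranslation L f) : IsDilatation L f := hf.choose_spec.1

/-- A translation is determined by its value at one point. -/
theorem ext (hf : IsTranslation L f) (hg : IsTranslation L g) {X : P} (h : f X = g X) :
    f = g := by
  obtain ⟨l, hl⟩ := hf
  obtain ⟨m, hm⟩ := hg
  by_cases hlm : Parallel l m
  · exact (hl.congr hlm).ext hm h
  · have hX : X = f X := Along.eq (hl.2 X) (h ▸ hm.2 X) hlm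
    exact (hl.eq_id hX.symm).trans (hm.eq_id (h ▸ hX.symm)).symm

theorem comp (hf : IsTranslation L f) (hg : IsTranslation L g) : IsTranslation L (f ∘ g) := by
  obtain ⟨l, hl⟩ := id hf
  obtain ⟨m, hm⟩ := id hg
  by_cases hlm : Parallel l m
  · exact ⟨m, (hl.congr hlm).comp hm⟩
  by_cases hfix : ∃ X, f (g X) = X
  · obtain ⟨X, hX⟩ := hfix
    have h1 : X = g X := Along.eq (by simpa only [hX] using (hl.2 (g X)).symm) (hm.2 X) hlm
    rw [hm.eq_id h1.symm]
    exact hf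
  · push Not at hfix
    obtain ⟨X, -⟩ := exists_notMem l
    obtain ⟨k, hX, hfX⟩ := exists_line_through (L := L) X ((f ∘ g) X)
    exact ⟨k, (hl.1.comp hm.1).isTranslationAlong hfix hX hfX⟩

end IsTranslation

/-- Both composites send `X` to the fourth vertex of the parallelogram on `X`, `f X`, `g X`. -/
theorem IsTranslationAlong.comm_of_not_parallel {l m : L} {f g : P → P}
    (hf : IsTranslationAlong l f) (hg : IsTranslationAlong m g) (hlm : ¬ Parallel l m) :
    f ∘ g = g ∘ f := by
  funext X
  exact Along.eq (l := l) (m := m)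
    ((hf.2 (g X)).symm.trans (hg.1 _ _ l (hf.2 X)))
    ((hf.1 _ _ m (hg.2 X)).symm.trans (hg.2 (f X))) hlm

end Affine

/-! ### Existence of homotheties and translations -/

variable [DesarguesPlane P L]

theorem isPencil_lines_through {O : P} {c : P → L}
    (hc : ∀ X, X ≠ O → O ∈ c X ∧ X ∈ c X) : IsPencil {X | X ≠ O} c where
  mem X hX := (hc X hX).2
  eq_of_mem X hX Y hY h := eq_of_mem_of_mem hY (hc Y hY).2 (hc Y hY).1 h (hc X hX).1
  parallel_or_concurrent := Or.inr ⟨O, fun X hX => (hc X hX).1⟩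
  -- An image equal to the center would make `l` parallel to `c X`, hence equal to it, and `Y` would
  -- lie on `c X`.
  mem_of_along := by
    rintro X hX X' hX' Y hY Y' l hXX hXY hXl hYl hal - rfl
    have h := hal.parallel hX' (hXX ▸ (hc X' hX').2) (hc X hX).1
    have hl : l = c X := eq_of_parallel_of_mem h hXl (hc X hX).2
    exact hXY (eq_of_mem_of_mem hY (hl ▸ hYl) (hc X hX).1 (hc Y hY).2 (hc Y hY).1)

/-- Homotheties with a given center, possibly constant, exist. -/
theorem exists_homothety {O I A : P} {l : L} (hOI : O ≠ I) (hO : O ∈ l) (hI : I ∈ l)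
    (hA : A ∈ l) : ∃ f : P → P, IsDilatation L f ∧ f O = O ∧ f I = A := by
  classical
  by_cases hAO : A = O
  · exact ⟨Function.const P O, .const O, rfl, hAO.symm⟩
  obtain ⟨B, hB⟩ := exists_notMem l
  have hBO : B ≠ O := (ne_of_mem_of_notMem hO hB).symm
  let c : P → L := fun X => if h : O = X then l else line L h
  have hc : ∀ X, X ≠ O → O ∈ c X ∧ X ∈ c X := fun X hX => by
    simp only [c, dif_neg (Ne.symm hX)]
    exact ⟨left_mem_line _, right_mem_line _⟩
  have hP : IsPencil {X | X ≠ O} c := isPencil_lines_through hc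
  have hcI : c I = l := eq_of_mem_of_mem hOI (hc I hOI.symm).1 (hc I hOI.symm).2 hO hI
  have hIB : c I ≠ c B := fun h => hB (hcI ▸ h ▸ (hc B hBO).2)
  -- The fourth vertex of the parallelogram on `O`, `I`, `B` is on neither `OI` nor `OB`, so it
  -- supplies the third line through `O`, even in the smallest plane.
  have hp : ¬ Parallel (parallelThrough B (c I)) (parallelThrough I (c B)) := fun h =>
    hIB <| eq_of_parallel_of_mem (parallel_trans (parallel_parallelThrough B (c I))
      (parallel_trans h (parallel_symm (parallel_parallelThrough I (c B)))))
      (hc I hOI.symm).1 (hc B hBO).1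
  have hZ1 : meet hp ∉ c I := fun h => by
    have h1 := eq_of_parallel_of_mem (parallel_parallelThrough B (c I)) h (meet_mem_left hp)
    exact hB (hcI ▸ h1 ▸ mem_parallelThrough B (c I))
  have hZ2 : meet hp ∉ c B := fun h => by
    have h1 := eq_of_parallel_of_mem (parallel_parallelThrough I (c B)) h (meet_mem_right hp)
    have h2 : I ∈ c B := h1 ▸ mem_parallelThrough I (c B)
    exact hIB (eq_of_mem_of_mem hOI (hc I hOI.symm).1 (hc I hOI.symm).2 (hc B hBO).1 h2)
  have hZO : meet hp ≠ O := fun h => hZ1 (h ▸ (hc I hOI.symm).1)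
  obtain ⟨f, hfI, hfD, hf⟩ := hP.exists_map (I := I) (A := A) (B := B) hOI.symm hAO hBO
    (hP.eq_of_mem I hOI.symm A hAO (hcI ▸ hA)) hIB
    (Or.inl ⟨meet hp, hZO, ne_of_mem_of_not_mem' (hc _ hZO).2 hZ1 |>.symm,
      ne_of_mem_of_not_mem' (hc _ hZO).2 hZ2 |>.symm⟩)
  have hg : ∀ X, X ≠ O → ParallelSegments L O X O (f X) := fun X hX =>
    .of_along hX.symm (along_of_mem (parallel_refl (c X)) (hc X hX).1 (hc X hX).2)
      (along_of_mem (parallel_refl (c X)) (hc X hX).1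
        ((hfD X hX).2 ▸ (hc (f X) (hfD X hX).1).2))
  refine ⟨Function.update f O O, fun X Y => ?_, Function.update_self .., ?_⟩
  · by_cases hX : X = O <;> by_cases hY : Y = O
    · exact .of_eq (by rw [hX, hY])
    · rw [hX, Function.update_self, Function.update_of_ne hY]
      exact hg Y hY
    · rw [hY, Function.update_self, Function.update_of_ne hX]
      exact (hg X hX).swap
    · rw [Function.update_of_ne hX, Function.update_of_ne hY]
      exact hf X hX Y hY
  · rw [Function.update_of_ne hOI.symm, hfI]

theorem parallelThrough_eq_iff {l : L} {X Y : P} :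
    parallelThrough X l = parallelThrough Y l ↔ Along l X Y :=
  ⟨fun h => by rw [Along, h]; exact mem_parallelThrough Y l,
    fun h => eq_parallelThrough h (parallel_parallelThrough X l)⟩

theorem isPencil_parallels (l : L) :
    IsPencil (Set.univ : Set P) (fun X => parallelThrough X l) where
  mem X _ := mem_parallelThrough X l
  eq_of_mem _ _ _ _ h := (parallelThrough_eq_iff.2 h).symm
  parallel_or_concurrent := Or.inl fun _ _ _ _ =>
    parallel_trans (parallel_symm (parallel_parallelThrough _ l)) (parallel_parallelThrough _ l)
  mem_of_along _ _ _ _ _ _ _ _ _ _ _ _ _ _ := trivial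

/-- If every point is on one of two parallel lines, then each of the two has just two points. -/
theorem eq_or_eq_of_two_parallels {l : L} {I A B B' X : P} (hIB : ¬ Along l I B)
    (h₂ : ∀ Z : P, Along l I Z ∨ Along l B Z) (hIA : Along l I A) (hBB : Along l B B')
    (hne : I ≠ A) (h : ParallelSegments L I B A B') (hX : Along l I X) : X = I ∨ X = A := by
  by_contra! hX'
  obtain ⟨u, hIu, hBu⟩ := exists_line_through (L := L) I B
  obtain ⟨v, hXv, hBv⟩ := exists_line_through (L := L) X B
  obtain ⟨w, hAw, hBw⟩ := exists_line_through (L := L) A B'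
  -- For a third point `X`, the lines `XB` and `AB'` would meet, with no place for the common point
  -- on either of the two parallels.
  have hAB : A ≠ B' := fun e => hIB (hIA.trans (e ▸ hBB.symm))
  have huw : Parallel u w := (h u (along_of_mem (parallel_refl u) hIu hBu)).parallel hAB hAw hBw
  have hul : ¬ Parallel l u := fun e => hIB (along_of_mem e hIu hBu)
  have hvl : ¬ Parallel l v := fun e => hIB (hX.trans (along_of_mem e hXv hBv))
  have hwl : ¬ Parallel l w := fun e => hul (parallel_trans e (parallel_symm huw))
  by_cases hvw : Parallel v w
  · have huv : u = v :=
      eq_of_parallel_of_mem (parallel_trans huw (parallel_symm hvw)) hBu hBv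
    exact hX'.1 (Along.eq hX (along_of_mem (parallel_refl u) hIu (huv ▸ hXv)) hul).symm
  · have hZv := meet_mem_left hvw
    have hZw := meet_mem_right hvw
    rcases h₂ (meet hvw) with hZ | hZ
    · have h1 : X = meet hvw := Along.eq (hX.symm.trans hZ)
        (along_of_mem (parallel_refl v) hXv hZv) hvl
      have h2 : A = meet hvw := Along.eq (hIA.symm.trans hZ)
        (along_of_mem (parallel_refl w) hAw hZw) hwl
      exact hX'.2 (h1.trans h2.symm)
    · have h1 : B = meet hvw := Along.eq hZ (along_of_mem (parallel_refl v) hBv hZv) hvl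
      have h2 : B' = meet hvw := Along.eq (hBB.symm.trans hZ)
        (along_of_mem (parallel_refl w) hBw hZw) hwl
      have h3 : u = w := eq_of_parallel_of_mem huw hBu (h1.trans h2.symm ▸ hBw)
      exact hne (Along.eq hIA (along_of_mem (parallel_refl u) hIu (h3 ▸ hAw)) hul)

theorem exists_isTranslationAlong {l : L} {I A : P} (hIA : Along l I A) :
    ∃ f : P → P, IsTranslationAlong l f ∧ f I = A := by
  by_cases hne : I = A
  · exact ⟨id, .id l, hne⟩
  obtain ⟨B, hB⟩ := exists_notMem (parallelThrough I l)
  have hIB : ¬ Along l I B := hB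
  have hP := isPencil_parallels (P := P) l
  obtain ⟨f, hfI, hfD, hf⟩ := hP.exists_map (I := I) (A := A) (B := B) trivial trivial trivial
    (parallelThrough_eq_iff.2 hIA.symm) (fun h => hIB (parallelThrough_eq_iff.1 h)) (by
      simp only [ne_eq, parallelThrough_eq_iff]
      by_cases h : ∃ Z, ¬ Along l I Z ∧ ¬ Along l B Z
      · obtain ⟨Z, hZ⟩ := h
        exact Or.inl ⟨Z, trivial, hZ⟩
      -- No third parallel exists, so the two lines are `{I, A}` and `{B, B'}`. The map has to swap
      -- the points of each, and the four segments are checked directly.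
      right
      intro B' _ X _ X' _ Y _ Y' _ hBB hX hX' hY hY' h₁ h₂ h₃
      have h4 : ∀ Z, Along l I Z ∨ Along l B Z := by
        intro Z
        by_contra hZ
        exact h ⟨Z, not_or.1 hZ⟩
      have hBne : B ≠ B' := fun e =>
        hne (hP.image_eq_of_fixed (X := B) (Y := I) (Y' := A) trivial trivial
          (fun e => hIB (parallelThrough_eq_iff.1 e.symm)) hIA h₁.swap e.symm).symm
      have tI : ∀ {Z}, Along l I Z → Z = I ∨ Z = A :=
        eq_or_eq_of_two_parallels hIB h4 hIA hBB.symm hne h₁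
      have tB : ∀ {Z}, Along l B Z → Z = B ∨ Z = B' :=
        eq_or_eq_of_two_parallels (fun e => hIB e.symm) (fun Z => (h4 Z).symm) hBB.symm hIA hBne
          h₁.swap
      have nAB : A ≠ B' := fun e => hIB (hIA.trans (e ▸ hBB))
      have cIB : parallelThrough I l ≠ parallelThrough B l :=
        fun e => hIB (parallelThrough_eq_iff.1 e)
      rcases tI hX.symm with rfl | rfl
      · obtain rfl : X' = A := hP.image_unique (X := B) trivial trivial cIB.symm hX'.symm hIA
          h₂ h₁.swap
        exact h₃
      rcases tB hY.symm with rfl | rfl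
      · obtain rfl : Y' = B' := hP.image_unique (X := I) trivial trivial cIB hY'.symm hBB.symm
          h₃ h₁
        exact h₂.swap
      have cXB : parallelThrough X l ≠ parallelThrough B l :=
        fun e => hIB (hIA.trans (parallelThrough_eq_iff.1 e))
      have cIY : parallelThrough I l ≠ parallelThrough Y l :=
        fun e => hIB ((parallelThrough_eq_iff.1 e).trans hBB)
      obtain rfl : X' = I := (tI hX'.symm).resolve_right fun e =>
        hBne (hP.image_eq_of_fixed trivial trivial cXB hBB.symm h₂.swap e).symm
      obtain rfl : Y' = B := (tB hY'.symm).resolve_right fun e =>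
        hne (hP.image_eq_of_fixed trivial trivial cIY.symm hX.symm h₃.swap e).symm
      exact h₁.inverse nAB)
  exact ⟨f, ⟨fun X Y => hf X trivial Y trivial, fun X =>
    parallelThrough_eq_iff.1 (hfD X trivial).2.symm⟩, hfI⟩

end Dilatation


/-! ### Commutativity of translations -/

section Translation

variable {P L : Type*} [Membership P L] [DesarguesPlane P L]

theorem IsTranslation.comm {f g : P → P} (hf : IsTranslation L f) (hg : IsTranslation L g) :
    f ∘ g = g ∘ f := by
  obtain ⟨l, hl⟩ := id hf
  obtain ⟨m, hm⟩ := id hg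
  by_cases hlm : Parallel l m
  swap
  · exact hl.comm_of_not_parallel hm hlm
  obtain ⟨X, -⟩ := exists_notMem l
  obtain ⟨W, hW⟩ := exists_notMem (parallelThrough X l)
  obtain ⟨k, hXk, hWk⟩ := exists_line_through (L := L) X W
  have hlk : ¬ Parallel l k := fun e => hW (along_of_mem e hXk hWk)
  -- For parallel directions, take `h` in another direction: `f` commutes with `h` and with `g ∘ h`,
  -- hence with `g`.
  obtain ⟨h, hk, hX⟩ := exists_isTranslationAlong (along_of_mem (parallel_refl k) hXk hWk)
  obtain ⟨n, hn⟩ := hg.comp ⟨k, hk⟩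
  have hln : ¬ Parallel l n := fun e => hW <| show Along l X W from
    hX ▸ ((hn.2 X).congr (parallel_symm e)).trans
      ((hm.2 (h X)).congr (parallel_symm hlm)).symm
  have h1 := congrFun (hl.comm_of_not_parallel hn hln) X
  have h2 := congrFun (hl.comm_of_not_parallel hk hlk) X
  simp only [Function.comp_apply] at h1 h2
  exact (hf.comp hg).ext (hg.comp hf) (X := h X) (by simp only [Function.comp_apply, h1, h2])

end Translation

end AffinePlane

/-! ### The skew field of points, via translations and homotheties -/

namespace PointsOn

open AffinePlane

variable {P L : Type*} [Membership P L] [DesarguesPlane P L] {O I : P} {hOI : O ≠ I}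

theorem along (A B : PointsOn L hOI) : Along (line L hOI) A.1 B.1 :=
  along_of_mem (parallel_refl _) A.2 B.2

theorem exists_translation (A : PointsOn L hOI) :
    ∃ f : P → P, IsTranslationAlong (line L hOI) f ∧ f O = A.1 :=
  exists_isTranslationAlong (along ptO A)

/-- The translation that maps `O` to `A`. -/
noncomputable def translation (A : PointsOn L hOI) : P → P := (exists_translation A).choose

theorem translation_along (A : PointsOn L hOI) :
    IsTranslationAlong (line L hOI) (translation A) := (exists_translation A).choose_spec.1

theorem isTranslation (A : PointsOn L hOI) : IsTranslation L (translation A) :=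
  ⟨_, translation_along A⟩

theorem translation_O (A : PointsOn L hOI) : translation A O = A.1 :=
  (exists_translation A).choose_spec.2

theorem eq_translation {A : PointsOn L hOI} {f : P → P} (hf : IsTranslation L f)
    (h : f O = A.1) : f = translation A :=
  hf.ext (isTranslation A) (h.trans (translation_O A).symm)

theorem exists_scaling (A : PointsOn L hOI) :
    ∃ f : P → P, IsDilatation L f ∧ f O = O ∧ f I = A.1 :=
  exists_homothety hOI (left_mem_line _) (right_mem_line _) A.2

/-- The homothety with center `O` that maps `I` to `A`. -/
noncomputable def scaling (A : PointsOn L hOI) : P → P := (exists_scaling A).choose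

theorem isDilatation (A : PointsOn L hOI) : IsDilatation L (scaling A) :=
  (exists_scaling A).choose_spec.1

theorem scaling_O (A : PointsOn L hOI) : scaling A O = O := (exists_scaling A).choose_spec.2.1

theorem scaling_I (A : PointsOn L hOI) : scaling A I = A.1 := (exists_scaling A).choose_spec.2.2

theorem eq_scaling {A : PointsOn L hOI} {f : P → P} (hf : IsDilatation L f) (hO : f O = O)
    (hI : f I = A.1) : f = scaling A :=
  hf.ext (isDilatation A) hOI (hO.trans (scaling_O A).symm) (hI.trans (scaling_I A).symm)

/-- The translation carries `OB₁` to the parallel through `A`, so `B₁` goes to P₁, and `BB₁` goes to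
the last line of the construction. -/
theorem addVia_eq {B₁ : P} (h : B₁ ∉ line L hOI) (A B : PointsOn L hOI) :
    (addVia h A B).1 = translation A B.1 := by
  have hf := translation_along A
  have h1 : translation A B₁ = meet (add_not_parallel h A) := eq_meet _ (hf.2 B₁) <| by
    have := hf.1 O B₁ _ (along_of_mem (parallel_refl _) (left_mem_line (ne_aux h ptO))
      (right_mem_line _))
    rwa [translation_O] at this
  refine (eq_meet (last_not_parallel h B _) ?_ ((hf.2 B.1).mem (parallel_refl _) B.2)).symm
  have := hf.1 B₁ B.1 _ (along_of_mem (parallel_refl _) (right_mem_line (ne_aux h B))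
      (left_mem_line _))
  rwa [h1] at this

theorem mulVia_eq {B₁ : P} (h : B₁ ∉ line L hOI) (A B : PointsOn L hOI) :
    (mulVia h A B).1 = scaling A B.1 := by
  have hf := isDilatation A
  have h1 : scaling A B₁ = meet (mul_not_parallel h A) := eq_meet _ (by
    have := hf I B₁ _ (along_of_mem (parallel_refl _) (left_mem_line (ne_aux h ptI))
      (right_mem_line _))
    rwa [scaling_I] at this)
    (hf.mem_of_fixed (scaling_O A) (left_mem_line (ne_aux h ptO)) (right_mem_line _))
  refine (eq_meet (last_not_parallel h B _) ?_ (hf.mem_of_fixed (scaling_O A) (left_mem_line _) B.2)).symm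
  have := hf B₁ B.1 _ (along_of_mem (parallel_refl _) (right_mem_line (ne_aux h B))
      (left_mem_line _))
  rwa [h1] at this

theorem add_val (A B : PointsOn L hOI) : (add A B).1 = translation A B.1 := addVia_eq _ A B

theorem mul_val (A B : PointsOn L hOI) : (mul A B).1 = scaling A B.1 := mulVia_eq _ A B

theorem translation_add (A B : PointsOn L hOI) :
    translation (add A B) = translation A ∘ translation B :=
  (eq_translation ((isTranslation A).comp (isTranslation B))
    (by rw [Function.comp_apply, translation_O, add_val])).symm

theorem translation_ptO : translation (ptO : PointsOn L hOI) = id :=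
  (eq_translation ⟨line L hOI, .id _⟩ rfl).symm

theorem scaling_mul (A B : PointsOn L hOI) : scaling (mul A B) = scaling A ∘ scaling B :=
  (eq_scaling ((isDilatation A).comp (isDilatation B))
    (by rw [Function.comp_apply, scaling_O, scaling_O])
    (by rw [Function.comp_apply, scaling_I, mul_val])).symm

theorem scaling_ptI : scaling (ptI : PointsOn L hOI) = id :=
  (eq_scaling .id rfl rfl).symm

theorem scaling_ptO : scaling (ptO : PointsOn L hOI) = Function.const P O :=
  (eq_scaling (.const O) rfl rfl).symm

theorem add_assoc (A B C : PointsOn L hOI) : add (add A B) C = add A (add B C) :=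
  Subtype.ext <| by simp only [add_val, translation_add, Function.comp_apply]

theorem zero_add (A : PointsOn L hOI) : add ptO A = A :=
  Subtype.ext <| by rw [add_val, translation_ptO, id]

theorem exists_neg (A : PointsOn L hOI) : ∃ B, add B A = ptO := by
  obtain ⟨f, hf, hA⟩ := exists_isTranslationAlong (along A ptO)
  let B : PointsOn L hOI := ⟨f O, Along.mem (hf.2 O) (parallel_refl _) (left_mem_line _)⟩
  have hB : f = translation B := eq_translation ⟨_, hf⟩ rfl
  refine ⟨B, Subtype.ext ?_⟩
  rw [add_val, ← hB]
  exact hA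

theorem mul_assoc (A B C : PointsOn L hOI) : mul (mul A B) C = mul A (mul B C) :=
  Subtype.ext <| by simp only [mul_val, scaling_mul, Function.comp_apply]

theorem one_mul (A : PointsOn L hOI) : mul ptI A = A :=
  Subtype.ext <| by rw [mul_val, scaling_ptI, id]

theorem mul_one (A : PointsOn L hOI) : mul A ptI = A :=
  Subtype.ext <| (mul_val A ptI).trans (scaling_I A)

theorem zero_mul (A : PointsOn L hOI) : mul ptO A = ptO :=
  Subtype.ext <| by rw [mul_val, scaling_ptO]; rfl

/-- Homotheties with center `O` commute with translations up to a change of the translation. -/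
theorem scaling_comp_translation (A B : PointsOn L hOI) :
    scaling A ∘ translation B = translation (mul A B) ∘ scaling A := by
  obtain ⟨Y, hY⟩ := exists_notMem (line L hOI)
  have hOY : O ≠ Y := ne_of_mem_of_notMem (left_mem_line hOI) hY
  have hYO : Along (line L hOY) O Y :=
    along_of_mem (parallel_refl _) (left_mem_line _) (right_mem_line _)
  have hp : ¬ Parallel (line L hOI) (line L hOY) :=
    not_parallel_of_mem (left_mem_line _) (left_mem_line _) hY (right_mem_line _)
  have hA := isDilatation A
  have hB := translation_along B
  have hAB := translation_along (mul A B)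
  have hO : (scaling A ∘ translation B) O = (translation (mul A B) ∘ scaling A) O := by
    simp only [Function.comp_apply, scaling_O, translation_O, mul_val]
  -- The two images of `Y` are joined in the direction `OI`, through `scaling A Y`, and in the
  -- direction `OY`, through the common image of `O`.
  refine (hA.comp hB.1).ext (hAB.1.comp hA) hOY hO (Along.eq (l := line L hOI) (m := line L hOY)
    ?_ ?_ hp)
  · exact (hA _ _ _ (hB.2 Y)).symm.trans (hAB.2 (scaling A Y))
  · exact ((hA.comp hB.1) _ _ _ hYO).symm.trans (hO ▸ (hAB.1.comp hA) _ _ _ hYO)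

theorem left_distrib (A B C : PointsOn L hOI) :
    mul A (add B C) = add (mul A B) (mul A C) := Subtype.ext <| by
  rw [mul_val, add_val, add_val, mul_val]
  exact congrFun (scaling_comp_translation A B) C.1

variable (L) in
theorem exists_isTranslation (X Y : P) : ∃ f : P → P, IsTranslation L f ∧ f X = Y := by
  obtain ⟨l, hX, hY⟩ := exists_line_through (L := L) X Y
  obtain ⟨f, hf, h⟩ := exists_isTranslationAlong (along_of_mem (parallel_refl l) hX hY)
  exact ⟨f, ⟨l, hf⟩, h⟩

/-- The pointwise sum of two dilatations, with respect to the origin `O`, is a dilatation. -/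
theorem isDilatation_sum {τ : P → P → P} {f g : P → P}
    (hτ : ∀ X, IsTranslation L (τ X)) (hO : ∀ X, τ X O = X) (hf : IsDilatation L f)
    (hg : IsDilatation L g) : IsDilatation L fun X => τ (f X) (g X) := by
  have hcomm : ∀ X Y, τ X Y = τ Y X := fun X Y => by
    have := congrFun ((hτ X).comm (hτ Y)) O
    simpa only [Function.comp_apply, hO] using this
  intro X Y l h
  -- Move the summands one at a time; commutativity lets the first one play the part of the
  -- translated point.
  refine ((hτ (f X)).isDilatation _ _ l (hg X Y l h)).trans ?_
  change Along l (τ (f X) (g Y)) (τ (f Y) (g Y))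
  rw [hcomm (f X), hcomm (f Y)]
  exact (hτ (g Y)).isDilatation _ _ l (hf X Y l h)

theorem right_distrib (A B C : PointsOn L hOI) :
    mul (add A B) C = add (mul A C) (mul B C) := by
  -- The sum of the two homotheties is needed on the whole plane, so translations are chosen for all
  -- points, not only those of `OI`.
  choose τ hτ hO using exists_isTranslation (P := P) L O
  have hτA : ∀ A : PointsOn L hOI, τ A.1 = translation A := fun A => eq_translation (hτ _) (hO _)
  have h := eq_scaling (A := add A B)
    (isDilatation_sum hτ hO (isDilatation A) (isDilatation B))
    (by rw [scaling_O, scaling_O, hO]) (by rw [scaling_I, scaling_I, hτA, add_val])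
  refine Subtype.ext ?_
  rw [mul_val, ← h, add_val, mul_val B, ← hτA, mul_val]

theorem ptO_ne_ptI : (ptO : PointsOn L hOI) ≠ ptI := fun h => hOI (congrArg Subtype.val h)

theorem exists_inv {A : PointsOn L hOI} (hA : A ≠ ptO) :
    ∃ C : PointsOn L hOI, mul A C = ptI ∧ mul C A = ptI := by
  have hAO : O ≠ A.1 := fun h => hA (Subtype.ext h.symm)
  obtain ⟨f, hf, hO, hfA⟩ := exists_homothety (l := line L hOI) hAO (left_mem_line hOI) A.2
    (right_mem_line hOI)
  let C : PointsOn L hOI := ⟨f I, hf.mem_of_fixed hO (left_mem_line _) (right_mem_line _)⟩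
  have hC : f = scaling C := eq_scaling hf hO rfl
  refine ⟨C, Subtype.ext ?_, Subtype.ext ?_⟩
  · have h : scaling A ∘ f = id := ((isDilatation A).comp hf).ext .id hAO
      (by rw [Function.comp_apply, hO, scaling_O, id])
      (by rw [Function.comp_apply, hfA, scaling_I, id])
    rw [mul_val]
    exact congrFun h I
  · rw [mul_val, ← hC]
    exact hfA

theorem mul_inv_cancel {A : PointsOn L hOI} (hA : A ≠ ptO) : mul A (inv A) = ptI := by
  rw [inv, dif_pos (exists_inv hA)]
  exact (exists_inv hA).choose_spec.1

theorem inv_ptO : inv (ptO : PointsOn L hOI) = ptO := by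
  refine dif_neg ?_
  rintro ⟨C, hC, -⟩
  exact ptO_ne_ptI ((zero_mul C).symm.trans hC)

/-- The ring of the points of the line `OI`. -/
noncomputable abbrev ring : Ring (PointsOn L hOI) :=
  letI : Add (PointsOn L hOI) := ⟨add⟩
  letI : Mul (PointsOn L hOI) := ⟨mul⟩
  letI : Zero (PointsOn L hOI) := ⟨ptO⟩
  letI : One (PointsOn L hOI) := ⟨ptI⟩
  letI : Neg (PointsOn L hOI) := ⟨fun A => (exists_neg A).choose⟩
  -- Commutativity of addition follows here from the two distributive laws.
  Ring.ofMinimalAxioms add_assoc zero_add (fun A => (exists_neg A).choose_spec) mul_assoc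
    one_mul mul_one left_distrib right_distrib

/-- The skew field of the points of the line `OI`. -/
noncomputable abbrev divisionRing : DivisionRing (PointsOn L hOI) :=
  { ring with
    inv := inv
    exists_pair_ne := ⟨ptO, ptI, ptO_ne_ptI⟩
    mul_inv_cancel := fun _ hA => mul_inv_cancel hA
    inv_zero := inv_ptO
    nnqsmul := _
    nnqsmul_def := fun _ _ => rfl
    qsmul := _
    qsmul_def := fun _ _ => rfl }

end PointsOn

/-! ### The ratio set -/

theorem mainTheorem2 {P L : Type*} [Membership P L] [DesarguesPlane P L] {O I : P}
    (hOI : O ≠ I) :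
    -- the two operations do not depend on the auxiliary point
    (∀ (B₁ : P) (h : B₁ ∉ AffinePlane.line L hOI) (A B : PointsOn L hOI),
      PointsOn.addVia h A B = PointsOn.add A B ∧ PointsOn.mulVia h A B = PointsOn.mul A B) ∧
    -- with them, the points of the line form a skew field `K`
    ∃ _K : DivisionRing (PointsOn L hOI),
      (∀ A B : PointsOn L hOI, A + B = PointsOn.add A B) ∧
      (∀ A B : PointsOn L hOI, A * B = PointsOn.mul A B) ∧
      (0 : PointsOn L hOI) = PointsOn.ptO ∧
      (1 : PointsOn L hOI) = PointsOn.ptI ∧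
      (∀ A : PointsOn L hOI, A⁻¹ = PointsOn.inv A) ∧
      ∀ B : PointsOn L hOI, B ≠ PointsOn.ptO →
        -- the set of ratios is a skew field under the same operations
        (∃ _F : DivisionRing (PointsOn.ratioSet B),
          (∀ R S : PointsOn.ratioSet B,
            ((R + S : PointsOn.ratioSet B) : PointsOn L hOI) = PointsOn.add R.1 S.1) ∧
          (∀ R S : PointsOn.ratioSet B,
            ((R * S : PointsOn.ratioSet B) : PointsOn L hOI) = PointsOn.mul R.1 S.1) ∧
          ((0 : PointsOn.ratioSet B) : PointsOn L hOI) = PointsOn.ratio B PointsOn.ptO ∧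
          ((1 : PointsOn.ratioSet B) : PointsOn L hOI) = PointsOn.ratio B B ∧
          (∀ X : PointsOn L hOI,
            ((-⟨PointsOn.ratio B X, PointsOn.ratio_mem B X⟩ : PointsOn.ratioSet B) :
              PointsOn L hOI) = PointsOn.ratio B (-X)) ∧
          (∀ X : PointsOn L hOI, X ≠ PointsOn.ptO →
            ((⟨PointsOn.ratio B X, PointsOn.ratio_mem B X⟩⁻¹ : PointsOn.ratioSet B) :
              PointsOn L hOI) = PointsOn.ratio X B)) ∧
        -- it is a sub-skew-field of `K`
        (∃ S : Subfield (PointsOn L hOI), (S : Set (PointsOn L hOI)) = PointsOn.ratioSet B) := by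
  refine ⟨fun B₁ h A B => ⟨Subtype.ext ?_, Subtype.ext ?_⟩, PointsOn.divisionRing,
    fun _ _ => rfl, fun _ _ => rfl, rfl, rfl, fun _ => rfl, fun B hB => ?_⟩
  · rw [PointsOn.addVia_eq, PointsOn.add_val]
  · rw [PointsOn.mulVia_eq, PointsOn.mul_val]
  let _ : DivisionRing (PointsOn L hOI) := PointsOn.divisionRing
  have hB0 : B ≠ 0 := hB
  have hratio : ∀ X Y : PointsOn L hOI, PointsOn.ratio X Y = X⁻¹ * Y := fun _ _ => rfl
  have htop : ((⊤ : Subfield (PointsOn L hOI)) : Set (PointsOn L hOI)) = PointsOn.ratioSet B := by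
    refine Set.ext fun R => ⟨fun _ => ⟨B * R, ?_⟩, fun _ => trivial⟩
    rw [hratio, inv_mul_cancel_left₀ hB0]
  refine ⟨?_, ⊤, htop⟩
  -- As every point is a ratio, the inclusion is a bijection, and the structure is pulled back along
  -- it.
  let e : PointsOn.ratioSet B ≃ PointsOn L hOI :=
    { toFun := Subtype.val
      invFun := fun X => ⟨X, htop.subset trivial⟩
      left_inv := fun _ => rfl
      right_inv := fun _ => rfl }
  refine ⟨e.divisionRing, fun _ _ => rfl, fun _ _ => rfl, ?_, ?_, fun X => ?_, fun X _ => ?_⟩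
  · exact (mul_zero B⁻¹).symm
  · exact (inv_mul_cancel₀ hB0).symm
  · exact (mul_neg B⁻¹ X).symm
  · exact (mul_inv_rev B⁻¹ X).trans (by rw [inv_inv, hratio])
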